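/- Let $N\ge 1$, $r\ge 0$, $s\ge 1$ be integers and let $\nu_1,\dots,\nu_r$ and $\mu_1,\dots,\mu_s$ be real numbers greater than $-1$ (for example non-negative integers). For $x>0$ and $1\le j\le N$ let $$I_j(x)=G^{r,s}_{s,r}\Big({-(\mu_1+j-1+N),\,-(\mu_2+N),\dots,-(\mu_s+N)\atop \nu_1,\dots,\nu_r}\Big|\,x\Big)=\frac1{2\pi i}\int_{c-i\infty}^{c+i\infty}\prod_{l=1}^r\Gamma(\nu_l-u)\;\Gamma(\mu_1+N+j+u)\prod_{l=2}^s\Gamma(\mu_l+N+1+u)\;x^u\,du$$ be the Meijer $G$-function, where the line $\operatorname{Re}u=c$ (which may depend on $j$) is any vertical line having all the poles of the factors $\Gamma(\nu_l-u)$ on its right and all the poles of the remaining Gamma factors on its left. Consider the function $$w(x_1,\dots,x_N)=\prod_{1\le j<k\le N}(x_k-x_j)\;\det\big[I_j(x_k)\big]_{j,k=1,\dots,N},\qquad x_1,\dots,x_N>0.$$ (Background, not part of the claim: $w$ is the unnormalized joint eigenvalue density of the product Wishart matrix $X^\dagger X$ with $X=G_r\cdots G_1(\tilde G_s\cdots\tilde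 G_1)^{-1}$, the $G_j$ and $\tilde G_l$ being independent $N\times N$ complex matrices with densities proportional to $(\det G_j^\dagger G_j)^{\nu_j}e^{-\mathrm{Tr}\,G_j^\dagger G_j}$ and $(\det\tilde G_l^\dagger\tilde G_l)^{\mu_l}e^{-\mathrm{Tr}\,\tilde G_l^\dagger\tilde G_l}$.) Put $\nu_0=0$ and $$C_l=(-1)^l\prod_{j=0}^r\Gamma(\nu_j+l+1)\prod_{p=1}^s\Gamma(\mu_p+N-l),\qquad l=0,\dots,N-1.$$ Then $w$ is real valued and Lebesgue integrable on $(0,\infty)^N$, and the factor by which it must be multiplied in order to be correctly normalized is $\frac{1}{N!}\prod_{l=0}^{N-1}\frac1{C_l}$: for a constant $K$, $$\int_{(0,\infty)^N}K\,w(x)\,dx_1\cdots dx_N=1\quad\Longleftrightarrow\quad K=\frac1{N!}\,\frac1{\prod_{l=0}^{N-1}C_l}.$$ -/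

import Mathlib

noncomputable section

/-- The Mellin symbol of the Meijer `G`-function `G^{m,n}_{p,q}`, with upper parameters `a` and
lower parameters `b` (numbered from `0`):
`∏_{j ≤ m} Γ(b_j - u) ∏_{j ≤ n} Γ(1 - a_j + u) / (∏_{j > m} Γ(1 - b_j + u) ∏_{j > n} Γ(a_j - u))`. -/
def meijerSymbol {p q : ℕ} (m n : ℕ) (a : Fin p → ℂ) (b : Fin q → ℂ) (u : ℂ) : ℂ :=
  ((∏ j : Fin q with j.val < m, Complex.Gamma (b j - u)) *
      ∏ j : Fin p with j.val < n, Complex.Gamma (1 - a j + u)) /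
    ((∏ j : Fin q with m ≤ j.val, Complex.Gamma (1 - b j + u)) *
      ∏ j : Fin p with n ≤ j.val, Complex.Gamma (a j - u))

/-- The vertical line `Re u = c` is an admissible contour for `G^{m,n}_{p,q}`: the poles of
`Γ(b_j - u)`, `j ≤ m`, lie to its right and those of `Γ(1 - a_j + u)`, `j ≤ n`, to its left. -/
def IsMeijerLine {p q : ℕ} (m n : ℕ) (a : Fin p → ℂ) (b : Fin q → ℂ) (c : ℝ) : Prop :=
  (∀ j : Fin q, j.val < m → c < (b j).re) ∧ (∀ j : Fin p, j.val < n → (a j).re - 1 < c)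

/-- The Meijer `G`-function as the contour integral
`(2πi)⁻¹ ∫_{c - i∞}^{c + i∞} meijerSymbol(u) z^u du`, parametrized by `u = c + i t`. -/
def meijerG {p q : ℕ} (m n : ℕ) (a : Fin p → ℂ) (b : Fin q → ℂ) (c : ℝ) (z : ℂ) : ℂ :=
  1 / (2 * (Real.pi : ℂ) * Complex.I) *
    ∫ t : ℝ, meijerSymbol m n a b ((c : ℂ) + (t : ℂ) * Complex.I) *
      z ^ ((c : ℂ) + (t : ℂ) * Complex.I) * Complex.I

/-- Upper parameters `-(μ₁ + j - 1 + N), -(μ₂ + N), …, -(μ_s + N)` of row `j` of the determinant;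
here `j : Fin N` is numbered from `0`, so it plays the role of `j - 1`. -/
def upperParam {N s : ℕ} (μ : Fin s → ℝ) (j : Fin N) : Fin s → ℂ := fun l =>
  if l.val = 0 then -((μ l : ℂ) + (j.val : ℂ) + (N : ℂ)) else -((μ l : ℂ) + (N : ℂ))

/-- Lower parameters `ν₁, …, ν_r`. -/
def lowerParam {r : ℕ} (ν : Fin r → ℝ) : Fin r → ℂ := fun l => (ν l : ℂ)

/-- `∏_{j < k} (x_k - x_j) · det [G^{r,s}_{s,r}(upperParam μ j; ν | x_k)]_{j,k}`, where the
`G`-function of row `j` is computed along the line `Re u = c j`. -/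
def eigenvalueWeight {N r s : ℕ} (ν : Fin r → ℝ) (μ : Fin s → ℝ) (c : Fin N → ℝ)
    (x : Fin N → ℝ) : ℂ :=
  (∏ j : Fin N, ∏ k ∈ Finset.Ioi j, ((x k : ℂ) - (x j : ℂ))) *
    (Matrix.of fun j k : Fin N =>
      meijerG r s (upperParam μ j) (lowerParam ν) (c j) (x k : ℂ)).det

/-- `C_l = (-1)^l ∏_{j=0}^r Γ(ν_j + l + 1) ∏_{p=1}^s Γ(μ_p + N - l)` with `ν₀ = 0`. -/
def normConst {r s : ℕ} (N : ℕ) (ν : Fin r → ℝ) (μ : Fin s → ℝ) (l : ℕ) : ℝ :=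
  (-1) ^ l *
    (∏ j : Fin (r + 1), Real.Gamma ((Fin.cons 0 ν : Fin (r + 1) → ℝ) j + (l : ℝ) + 1)) *
    ∏ p : Fin s, Real.Gamma (μ p + (N : ℝ) - (l : ℝ))

end

open MeasureTheory Set Filter Topology ComplexConjugate

/-! Each entry of the determinant is an inverse Mellin transform of a product of Gamma functions.
Products of Mellin transforms correspond to multiplicative convolutions, so convolving `x ^ a * exp
(-x)` and its reflections under `x ↦ x⁻¹` produces a real continuous `f j` whose Mellin transform is
that product on the whole admissible strip (`exists_mellinPair_gammaProd`). Mellin inversion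
identifies the contour integral with `f j` on every admissible line (`mellinInv_gammaProd`), so no
contour is ever shifted.

The weight is thus a Vandermonde determinant times `det [f j (x k)]`. Andréief's identity
(`integral_det_mul_det`) gives integrability and the value `N!` times the determinant of the moments
`∫ x ^ p * f j x`, which are Gamma products at `p + 1`. Only one Gamma factor depends on the column,
through a shift by `j`; shifts of Gamma are monic polynomials of degree `j`, so the determinant
reduces to a Vandermonde at equally spaced points (`det_gammaProd`). The resulting product of the
`C_l` is nonzero, which yields the equivalence for `K`. -/

/-! ### Mellin pairs and multiplicative convolution -/

/-- `f` is a real continuous function on `(0, ∞)` whose Mellin transform converges to `F` on the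
vertical lines `Re s ∈ S`, with the corresponding pointwise power bounds. -/
structure MellinPair (f : ℝ → ℂ) (F : ℂ → ℂ) (S : Set ℝ) : Prop where
  continuousOn : ContinuousOn f (Ioi 0)
  bound : ∀ σ ∈ S, ∃ C : ℝ, ∀ x : ℝ, 0 < x → ‖f x‖ ≤ C * x ^ (-σ)
  conj_eq : ∀ x : ℝ, 0 < x → conj (f x) = f x
  hasMellin : ∀ s : ℂ, s.re ∈ S → HasMellin f s (F s)

theorem MellinPair.mono {f : ℝ → ℂ} {F : ℂ → ℂ} {S T : Set ℝ} (h : MellinPair f F T)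
    (hST : S ⊆ T) : MellinPair f F S :=
  ⟨h.continuousOn, fun σ hσ => h.bound σ (hST hσ), h.conj_eq, fun s hs => h.hasMellin s (hST hs)⟩

theorem MellinPair.comp_inv {f : ℝ → ℂ} {F : ℂ → ℂ} {S : Set ℝ} (h : MellinPair f F S) :
    MellinPair (fun x => f x⁻¹) (fun s => F (-s)) (-S) where
  continuousOn := h.continuousOn.comp (continuousOn_inv₀.mono fun x hx => (ne_of_gt hx : x ≠ 0))
    fun x hx => mem_Ioi.2 (inv_pos.2 (mem_Ioi.1 hx))
  bound σ hσ := by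
    obtain ⟨C, hC⟩ := h.bound _ hσ
    refine ⟨C, fun x hx => (hC _ (inv_pos.2 hx)).trans_eq ?_⟩
    rw [Real.inv_rpow hx.le, ← Real.rpow_neg hx.le, neg_neg]
  conj_eq x hx := h.conj_eq _ (inv_pos.2 hx)
  hasMellin s hs := by
    obtain ⟨h1, h2⟩ := h.hasMellin (-s) (by simpa using hs)
    refine ⟨?_, by rw [mellin_comp_inv, h2]⟩
    have := MellinConvergent.comp_rpow (f := f) (s := s) (a := -1) (by norm_num)
    simp only [Real.rpow_neg_one, Complex.ofReal_neg, Complex.ofReal_one, div_neg, div_one] at this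
    exact this.2 h1

theorem continuousOn_cpow_mul {f : ℝ → ℂ} (hf : ContinuousOn f (Ioi 0)) (s : ℂ) :
    ContinuousOn (fun t : ℝ => (t : ℂ) ^ s * f t) (Ioi 0) :=
  (continuousOn_of_forall_continuousAt fun _ ht =>
    Complex.continuousAt_ofReal_cpow_const _ _ (Or.inr (ne_of_gt ht))).mul hf

/-- Fubini for a multiplicative convolution on `(0, ∞)`. -/
theorem integral_mulConvolution {k K : ℝ → ℂ} (hk : ContinuousOn k (Ioi 0))
    (hK : ContinuousOn K (Ioi 0)) (hki : IntegrableOn k (Ioi 0)) (hKi : IntegrableOn K (Ioi 0)) :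
    IntegrableOn (fun x : ℝ => ∫ y in Ioi (0 : ℝ), K y * (y : ℂ)⁻¹ * k (y⁻¹ * x)) (Ioi 0) ∧
    ∫ x in Ioi (0 : ℝ), ∫ y in Ioi (0 : ℝ), K y * (y : ℂ)⁻¹ * k (y⁻¹ * x) =
      (∫ x in Ioi (0 : ℝ), k x) * ∫ y in Ioi (0 : ℝ), K y := by
  -- The Jacobian of `x ↦ y⁻¹ * x` cancels the factor `y⁻¹`, so the iterated norm integral splits
  -- into a product.
  have hnorm : ∀ y : ℝ, 0 < y → ∫ x in Ioi (0 : ℝ), ‖K y * (y : ℂ)⁻¹ * k (y⁻¹ * x)‖ =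
      ‖K y‖ * ∫ x in Ioi (0 : ℝ), ‖k x‖ := by
    intro y hy
    simp_rw [norm_mul]
    rw [integral_const_mul,
      integral_comp_mul_left_Ioi (fun x => ‖k x‖) 0 (inv_pos.2 hy)]
    simp only [norm_inv, Complex.norm_real, Real.norm_eq_abs, abs_of_pos hy, inv_inv, mul_zero,
      smul_eq_mul]
    field_simp
  have hval : ∀ y : ℝ, 0 < y → ∫ x in Ioi (0 : ℝ), K y * (y : ℂ)⁻¹ * k (y⁻¹ * x) =
      K y * ∫ x in Ioi (0 : ℝ), k x := by
    intro y hy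
    rw [integral_const_mul, integral_comp_mul_left_Ioi k 0 (inv_pos.2 hy)]
    have : (y : ℂ) ≠ 0 := by exact_mod_cast hy.ne'
    simp only [inv_inv, mul_zero, Complex.real_smul]
    field_simp
  have hint : Integrable (fun p : ℝ × ℝ => K p.2 * (p.2 : ℂ)⁻¹ * k (p.2⁻¹ * p.1))
      ((volume.restrict (Ioi 0)).prod (volume.restrict (Ioi 0))) := by
    have hcont : ContinuousOn (fun p : ℝ × ℝ => K p.2 * (p.2 : ℂ)⁻¹ * k (p.2⁻¹ * p.1))
        (Ioi 0 ×ˢ Ioi 0) := by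
      refine ((hK.comp continuousOn_snd fun p hp => hp.2).mul
        (ContinuousOn.inv₀ (by fun_prop) fun p hp => ?_)).mul
        (hk.comp (t := Ioi 0) (f := fun p : ℝ × ℝ => p.2⁻¹ * p.1)
          ((ContinuousOn.inv₀ (by fun_prop) fun p hp => (mem_Ioi.1 hp.2).ne').mul
            continuousOn_fst) fun p hp => mem_Ioi.2 (mul_pos (inv_pos.2 hp.2) hp.1))
      exact_mod_cast (ne_of_gt hp.2 : p.2 ≠ 0)
    have hmeas := hcont.aestronglyMeasurable (μ := (volume : Measure ℝ).prod volume)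
      (measurableSet_Ioi.prod measurableSet_Ioi)
    rw [← Measure.prod_restrict] at hmeas
    rw [integrable_prod_iff' hmeas]
    constructor
    · refine (ae_restrict_iff' measurableSet_Ioi).2 (ae_of_all _ fun y hy => ?_)
      have hy' : (0 : ℝ) < y⁻¹ := inv_pos.2 hy
      have := (integrableOn_Ioi_comp_mul_left_iff k 0 hy').2 (by simpa using hki)
      exact Integrable.const_mul this (K y * (y : ℂ)⁻¹)
    · refine Integrable.congr (hKi.norm.mul_const (∫ x in Ioi (0 : ℝ), ‖k x‖)) ?_
      refine (ae_restrict_iff' measurableSet_Ioi).2 (ae_of_all _ fun y hy => ?_)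
      exact (hnorm y hy).symm
  refine ⟨hint.integral_prod_left, ?_⟩
  rw [integral_integral_swap hint, setIntegral_congr_fun measurableSet_Ioi hval,
    integral_mul_const, mul_comm]

/-- The power bound on `f` at exponent `σ` dominates the integrand by `x ^ (-σ)` times the
absolutely convergent Mellin integrand of `g`. This one estimate gives both continuity and the new
power bound; Fubini gives the product of transforms. -/
theorem MellinPair.convolution {f g : ℝ → ℂ} {F G : ℂ → ℂ} {S : Set ℝ} (hS : S.Nonempty)
    (hf : MellinPair f F S) (hg : MellinPair g G S) :
    MellinPair (fun x => ∫ y in Ioi (0 : ℝ), g y * (y : ℂ)⁻¹ * f (y⁻¹ * x))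
      (fun s => F s * G s) S := by
  have hgi : ∀ σ ∈ S, IntegrableOn (fun y : ℝ => y ^ (σ - 1) * ‖g y‖) (Ioi 0) := fun σ hσ => by
    have := (hg.hasMellin (σ : ℂ) (by simpa using hσ)).1
    rw [MellinConvergent, mellin_convergent_iff_norm Subset.rfl measurableSet_Ioi
      (hg.continuousOn.aestronglyMeasurable measurableSet_Ioi)] at this
    simpa using this
  have hbd : ∀ σ ∈ S, ∃ C : ℝ, 0 ≤ C ∧ ∀ x y : ℝ, 0 < x → 0 < y →
      ‖g y * (y : ℂ)⁻¹ * f (y⁻¹ * x)‖ ≤ C * x ^ (-σ) * (y ^ (σ - 1) * ‖g y‖) := by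
    intro σ hσ
    obtain ⟨C, hC⟩ := hf.bound σ hσ
    refine ⟨C, by simpa using (norm_nonneg _).trans (hC 1 one_pos), fun x y hx hy => ?_⟩
    have h1 := hC (y⁻¹ * x) (mul_pos (inv_pos.2 hy) hx)
    rw [norm_mul, norm_mul, norm_inv, Complex.norm_real, Real.norm_eq_abs, abs_of_pos hy]
    calc ‖g y‖ * y⁻¹ * ‖f (y⁻¹ * x)‖ ≤ ‖g y‖ * y⁻¹ * (C * (y⁻¹ * x) ^ (-σ)) := by gcongr
      _ = _ := by
        rw [Real.mul_rpow (inv_pos.2 hy).le hx.le, Real.inv_rpow hy.le, ← Real.rpow_neg hy.le,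
          neg_neg, Real.rpow_sub_one hy.ne']
        ring
  have hcy : ∀ x : ℝ, 0 < x →
      ContinuousOn (fun y : ℝ => g y * (y : ℂ)⁻¹ * f (y⁻¹ * x)) (Ioi 0) := fun x hx => by
    refine (hg.continuousOn.mul (ContinuousOn.inv₀ (by fun_prop) fun y hy => ?_)).mul
      (hf.continuousOn.comp (t := Ioi 0) (f := fun y : ℝ => y⁻¹ * x)
        ((ContinuousOn.inv₀ (by fun_prop) fun y hy => (mem_Ioi.1 hy).ne').mul
          continuousOn_const) fun y hy => mem_Ioi.2 (mul_pos (inv_pos.2 hy) hx))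
    exact_mod_cast (ne_of_gt hy : y ≠ 0)
  refine ⟨?_, ?_, ?_, ?_⟩
  · obtain ⟨σ, hσ⟩ := hS
    obtain ⟨C, hC0, hC⟩ := hbd σ hσ
    refine continuousOn_of_forall_continuousAt fun x₀ (hx₀ : 0 < x₀) => ?_
    have hev : ∀ᶠ x in 𝓝 x₀, 0 < x ∧ x ^ (-σ) ≤ x₀ ^ (-σ) + 1 :=
      (lt_mem_nhds hx₀).and
        ((Real.continuousAt_rpow_const x₀ (-σ) (Or.inl hx₀.ne')).eventually
          (ge_mem_nhds (lt_add_one _)))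
    refine continuousAt_of_dominated
      (bound := fun y => C * (x₀ ^ (-σ) + 1) * (y ^ (σ - 1) * ‖g y‖)) ?_ ?_ ?_ ?_
    · exact hev.mono fun x hx => (hcy x hx.1).aestronglyMeasurable measurableSet_Ioi
    · refine hev.mono fun x hx => (ae_restrict_iff' measurableSet_Ioi).2
        (ae_of_all _ fun y (hy : 0 < y) => (hC x y hx.1 hy).trans ?_)
      have := Real.rpow_nonneg hy.le (σ - 1)
      gcongr
      exact hx.2
    · exact (hgi σ hσ).const_mul _
    · refine (ae_restrict_iff' measurableSet_Ioi).2 (ae_of_all _ fun y (hy : 0 < y) => ?_)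
      refine continuousAt_const.mul (ContinuousAt.comp (f := fun x => y⁻¹ * x) ?_ (by fun_prop))
      exact hf.continuousOn.continuousAt (Ioi_mem_nhds (mul_pos (inv_pos.2 hy) hx₀))
  · intro σ hσ
    obtain ⟨C, hC0, hC⟩ := hbd σ hσ
    refine ⟨C * ∫ y in Ioi (0 : ℝ), y ^ (σ - 1) * ‖g y‖, fun x hx => ?_⟩
    refine (norm_integral_le_of_norm_le ((hgi σ hσ).const_mul (C * x ^ (-σ)))
      ((ae_restrict_iff' measurableSet_Ioi).2 (ae_of_all _ fun y hy => hC x y hx hy))).trans_eq ?_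
    rw [integral_const_mul]
    ring
  · intro x hx
    rw [← integral_conj]
    refine setIntegral_congr_fun measurableSet_Ioi fun y hy => ?_
    simp only [map_mul, map_inv₀, Complex.conj_ofReal, hg.conj_eq y hy,
      hf.conj_eq _ (mul_pos (inv_pos.2 hy) hx)]
  · intro s hs
    obtain ⟨hf1, hf2⟩ := hf.hasMellin s hs
    obtain ⟨hg1, hg2⟩ := hg.hasMellin s hs
    obtain ⟨h1, h2⟩ := integral_mulConvolution (continuousOn_cpow_mul hf.continuousOn (s - 1))
      (continuousOn_cpow_mul hg.continuousOn (s - 1)) hf1 hg1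
    have key : EqOn (fun x : ℝ => ∫ y in Ioi (0 : ℝ), (y : ℂ) ^ (s - 1) * g y * (y : ℂ)⁻¹ *
        (((y⁻¹ * x : ℝ) : ℂ) ^ (s - 1) * f (y⁻¹ * x)))
        (fun x : ℝ => (x : ℂ) ^ (s - 1) • ∫ y in Ioi (0 : ℝ), g y * (y : ℂ)⁻¹ * f (y⁻¹ * x))
        (Ioi 0) := by
      intro x (hx : 0 < x)
      dsimp only
      rw [smul_eq_mul, ← integral_const_mul]
      refine setIntegral_congr_fun measurableSet_Ioi fun y (hy : 0 < y) => ?_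
      -- Splitting the power along `x = y * (y⁻¹ * x)` makes this the convolution of the two Mellin
      -- integrands.
      have e : (x : ℂ) ^ (s - 1) = (y : ℂ) ^ (s - 1) * ((y⁻¹ * x : ℝ) : ℂ) ^ (s - 1) := by
        rw [← Complex.mul_cpow_ofReal_nonneg hy.le (mul_pos (inv_pos.2 hy) hx).le,
          ← Complex.ofReal_mul, mul_inv_cancel_left₀ hy.ne']
      rw [e]
      ring
    refine ⟨h1.congr_fun key measurableSet_Ioi, ?_⟩
    rw [mellin, ← setIntegral_congr_fun measurableSet_Ioi key, h2, ← hf2, ← hg2]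
    simp [mellin]

/-! ### Gamma factors as Mellin transforms -/

theorem mellinPair_Gamma (a : ℝ) :
    MellinPair (fun x : ℝ => (x : ℂ) ^ (a : ℂ) * (Real.exp (-x) : ℂ))
      (fun s => Complex.Gamma (a + s)) (Ioi (-a)) where
  continuousOn := continuousOn_cpow_mul (by fun_prop) a
  bound σ hσ := by
    have hp : 0 < a + σ := by linarith [mem_Ioi.1 hσ]
    -- With `p = a + σ`, raising `x ≤ p * exp (x / p)` to the power `p` gives `x ^ p ≤ p ^ p * exp
    -- x`.
    refine ⟨(a + σ) ^ (a + σ), fun x hx => ?_⟩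
    rw [norm_mul, Complex.norm_cpow_eq_rpow_re_of_pos hx, Complex.ofReal_re, Complex.norm_real,
      Real.norm_eq_abs, Real.abs_exp]
    have h1 : x ≤ (a + σ) * Real.exp (x / (a + σ)) := by
      have := Real.add_one_le_exp (x / (a + σ))
      have h2 : x = (a + σ) * (x / (a + σ)) := by field_simp
      calc x = (a + σ) * (x / (a + σ)) := h2
        _ ≤ _ := by gcongr; linarith
    have h3 : x ^ (a + σ) ≤ (a + σ) ^ (a + σ) * Real.exp x := by
      refine (Real.rpow_le_rpow hx.le h1 hp.le).trans_eq ?_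
      rw [Real.mul_rpow hp.le (Real.exp_pos _).le, ← Real.exp_mul]
      congr 2
      field_simp
    calc x ^ a * Real.exp (-x) = x ^ (a + σ) * x ^ (-σ) * Real.exp (-x) := by
          rw [← Real.rpow_add hx, add_neg_cancel_right]
      _ ≤ (a + σ) ^ (a + σ) * Real.exp x * x ^ (-σ) * Real.exp (-x) := by gcongr
      _ = (a + σ) ^ (a + σ) * x ^ (-σ) * (Real.exp x * Real.exp (-x)) := by ring
      _ = _ := by rw [← Real.exp_add, add_neg_cancel, Real.exp_zero, mul_one]
  conj_eq x hx := by
    rw [← Complex.ofReal_cpow hx.le, map_mul, Complex.conj_ofReal, Complex.conj_ofReal]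
  hasMellin s hs := by
    have hre : 0 < (s + a).re := by
      simp only [Complex.add_re, Complex.ofReal_re]
      linarith [mem_Ioi.1 hs]
    have hc : MellinConvergent (fun x : ℝ => (Real.exp (-x) : ℂ)) (s + a) := by
      have := Complex.GammaIntegral_convergent hre
      refine this.congr_fun (fun x _ => ?_) measurableSet_Ioi
      simp [mul_comm]
    refine ⟨(MellinConvergent.cpow_smul (a := (a : ℂ))).2 hc, ?_⟩
    have := mellin_cpow_smul (fun x : ℝ => (Real.exp (-x) : ℂ)) s a
    simp only [smul_eq_mul] at this
    rw [this, add_comm (a : ℂ), Complex.Gamma_eq_integral hre, Complex.GammaIntegral_eq_mellin]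

theorem mellinPair_Gamma_sub (b : ℝ) :
    MellinPair (fun x : ℝ => ((x⁻¹ : ℝ) : ℂ) ^ (b : ℂ) * (Real.exp (-x⁻¹) : ℂ))
      (fun s => Complex.Gamma (b - s)) (Iio b) := by
  have := (mellinPair_Gamma b).comp_inv
  simpa only [sub_eq_add_neg, neg_Ioi, neg_neg] using this

/-- Convolution has no unit among functions, so the induction starts from a given pair instead of
the empty product; `1 ≤ s` later supplies that first factor. -/
theorem exists_mellinPair_prod {ι : Type*} {S : Set ℝ} (hS : S.Nonempty) (t : Finset ι)
    {G : ι → ℂ → ℂ} (hG : ∀ i ∈ t, ∃ g, MellinPair g (G i) S) {f : ℝ → ℂ} {F : ℂ → ℂ}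
    (hf : MellinPair f F S) : ∃ h, MellinPair h (fun s => F s * ∏ i ∈ t, G i s) S := by
  classical
  induction t using Finset.induction_on with
  | empty => exact ⟨f, by simpa using hf⟩
  | insert i t hi ih =>
    obtain ⟨h, hh⟩ := ih fun j hj => hG j (Finset.mem_insert_of_mem hj)
    obtain ⟨g, hg⟩ := hG i (Finset.mem_insert_self _ _)
    have e : (fun s => F s * ∏ j ∈ insert i t, G j s) =
        fun s => (F s * ∏ j ∈ t, G j s) * G i s := by
      funext s
      rw [Finset.prod_insert hi]
      ring
    exact ⟨_, e ▸ hh.convolution hS hg⟩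

/-- The admissible lines for the Mellin transform `∏ Γ(ν_l + s) ∏ Γ(b_l - s)`. -/
def gammaStrip {r s : ℕ} (ν : Fin r → ℝ) (b : Fin s → ℝ) : Set ℝ :=
  {σ | (∀ l, -ν l < σ) ∧ ∀ l, σ < b l}

/-- The product `∏ Γ(ν_l + z) ∏ Γ(b_l - z)`. -/
noncomputable def gammaProd {r s : ℕ} (ν : Fin r → ℝ) (b : Fin s → ℝ) (z : ℂ) : ℂ :=
  (∏ l, Complex.Gamma (ν l + z)) * ∏ l, Complex.Gamma (b l - z)

theorem exists_mellinPair_gammaProd {r s : ℕ} (hs : 1 ≤ s) (ν : Fin r → ℝ) (b : Fin s → ℝ)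
    (hS : (gammaStrip ν b).Nonempty) :
    ∃ f, MellinPair f (gammaProd ν b) (gammaStrip ν b) := by
  let i₀ : Fin s := ⟨0, hs⟩
  have hb : ∀ l, ∃ g, MellinPair g (fun z => Complex.Gamma (b l - z)) (gammaStrip ν b) :=
    fun l => ⟨_, (mellinPair_Gamma_sub (b l)).mono fun σ hσ => hσ.2 l⟩
  have hn : ∀ l, ∃ g, MellinPair g (fun z => Complex.Gamma (ν l + z)) (gammaStrip ν b) :=
    fun l => ⟨_, (mellinPair_Gamma (ν l)).mono fun σ hσ => hσ.1 l⟩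
  obtain ⟨f₀, h₀⟩ := hb i₀
  obtain ⟨f₁, h₁⟩ := exists_mellinPair_prod hS (Finset.univ.erase i₀) (fun l _ => hb l) h₀
  obtain ⟨f₂, h₂⟩ := exists_mellinPair_prod hS Finset.univ (fun l _ => hn l) h₁
  refine ⟨f₂, ?_⟩
  convert h₂ using 2 with z
  rw [gammaProd, Finset.mul_prod_erase Finset.univ (fun l => Complex.Gamma (b l - z))
    (Finset.mem_univ i₀), mul_comm]

/-! ### Decay on vertical lines and Mellin inversion -/

theorem norm_Gamma_le_Gamma_re {z : ℂ} (hz : 0 < z.re) :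
    ‖Complex.Gamma z‖ ≤ Real.Gamma z.re := by
  rw [Complex.Gamma_eq_integral hz, Real.Gamma_eq_integral hz, Complex.GammaIntegral]
  refine (norm_integral_le_integral_norm _).trans_eq
    (setIntegral_congr_fun measurableSet_Ioi fun x (hx : 0 < x) => ?_)
  simp [Complex.norm_cpow_eq_rpow_re_of_pos hx, Complex.norm_exp]

theorem continuous_Gamma_vertical {σ : ℝ} (hσ : 0 < σ) {ε : ℝ} :
    Continuous fun t : ℝ => Complex.Gamma (σ + (ε * t : ℝ) * Complex.I) := by
  refine continuous_iff_continuousAt.2 fun t => ?_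
  refine ContinuousAt.comp (g := Complex.Gamma)
    (f := fun t : ℝ => (σ : ℂ) + (ε * t : ℝ) * Complex.I) ?_ (by fun_prop)
  refine (Complex.differentiableAt_Gamma _ fun m h => ?_).continuousAt
  have := congrArg Complex.re h
  simp at this
  have : (0 : ℝ) ≤ m := m.cast_nonneg
  linarith

/-- Quadratic decay of the Gamma function on a vertical line. -/
theorem norm_Gamma_vertical_le {σ : ℝ} (hσ : 0 < σ) :
    ∃ C : ℝ, ∀ t : ℝ, ‖Complex.Gamma (σ + t * Complex.I)‖ ≤ C * (1 + t ^ 2)⁻¹ := by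
  obtain ⟨m, hm0, hm⟩ : ∃ m : ℝ, 0 < m ∧ ∀ t : ℝ, m * (1 + t ^ 2) ≤ σ ^ 2 + t ^ 2 := by
    refine ⟨min 1 (σ ^ 2), by positivity, fun t => ?_⟩
    nlinarith [min_le_left 1 (σ ^ 2), min_le_right 1 (σ ^ 2), sq_nonneg t,
      mul_le_mul_of_nonneg_right (min_le_left 1 (σ ^ 2)) (sq_nonneg t)]
  -- From `Γ(z + 2) = (z + 1) z Γ(z)`, `‖Γ(z + 2)‖ ≤ Γ(σ + 2)` and `‖z + 1‖ * ‖z‖ ≥ ‖z‖ ^ 2 ≥ m * (1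
  -- + t ^ 2)`.
  refine ⟨Real.Gamma (σ + 2) / m, fun t => ?_⟩
  set z : ℂ := σ + t * Complex.I with hz
  have hre : z.re = σ := by simp [hz]
  have him : z.im = t := by simp [hz]
  have hz0 : z ≠ 0 := fun h => by
    have := congrArg Complex.re h
    rw [hre] at this
    exact hσ.ne' this
  have hz1 : z + 1 ≠ 0 := fun h => by
    have := congrArg Complex.re h
    rw [Complex.add_re, hre] at this
    simp at this
    linarith
  have hrec : Complex.Gamma (z + 2) = (z + 1) * (z * Complex.Gamma z) := by
    rw [← Complex.Gamma_add_one z hz0, ← Complex.Gamma_add_one _ hz1]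
    ring_nf
  have hle := norm_Gamma_le_Gamma_re (z := z + 2) (by simp [hre]; linarith)
  rw [hrec, norm_mul, norm_mul] at hle
  simp only [Complex.add_re, hre, Complex.re_ofNat] at hle
  have hsq : ‖z‖ ^ 2 = σ ^ 2 + t ^ 2 := by
    rw [← Complex.normSq_eq_norm_sq, Complex.normSq_apply, hre, him]
    ring
  have hsq1 : ‖z‖ ≤ ‖z + 1‖ := by
    rw [← sq_le_sq₀ (norm_nonneg _) (norm_nonneg _), ← Complex.normSq_eq_norm_sq,
      ← Complex.normSq_eq_norm_sq, Complex.normSq_apply, Complex.normSq_apply]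
    simp only [Complex.add_re, Complex.add_im, hre, him, Complex.one_re, Complex.one_im]
    nlinarith
  have h5 : m * (1 + t ^ 2) * ‖Complex.Gamma z‖ ≤ Real.Gamma (σ + 2) := by
    calc m * (1 + t ^ 2) * ‖Complex.Gamma z‖ ≤ ‖z‖ ^ 2 * ‖Complex.Gamma z‖ := by
          rw [hsq]; gcongr; exact hm t
      _ = ‖z‖ * (‖z‖ * ‖Complex.Gamma z‖) := by ring
      _ ≤ ‖z + 1‖ * (‖z‖ * ‖Complex.Gamma z‖) := by gcongr
      _ ≤ _ := hle
  rw [div_mul_eq_mul_div, le_div_iff₀ hm0, ← div_eq_mul_inv, le_div_iff₀ (by positivity)]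
  linarith

/-- One factor `Γ(b - z)`, available since `1 ≤ s`, decays quadratically; every other factor is
bounded by its value on the real axis. -/
theorem verticalIntegrable_gammaProd {r s : ℕ} (hs : 1 ≤ s) (ν : Fin r → ℝ) (b : Fin s → ℝ)
    {σ : ℝ} (hσ : σ ∈ gammaStrip ν b) : Complex.VerticalIntegrable (gammaProd ν b) σ := by
  let i₀ : Fin s := ⟨0, hs⟩
  have en : ∀ (l : Fin r) (t : ℝ), (ν l : ℂ) + (σ + t * Complex.I) =
      ((ν l + σ : ℝ) : ℂ) + ((1 : ℝ) * t : ℝ) * Complex.I := fun l t => by push_cast; ring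
  have eb : ∀ (l : Fin s) (t : ℝ), (b l : ℂ) - (σ + t * Complex.I) =
      ((b l - σ : ℝ) : ℂ) + ((-1 : ℝ) * t : ℝ) * Complex.I := fun l t => by push_cast; ring
  have hn : ∀ l, 0 < ν l + σ := fun l => by linarith [hσ.1 l]
  have hb : ∀ l, 0 < b l - σ := fun l => by linarith [hσ.2 l]
  obtain ⟨C, hC⟩ := norm_Gamma_vertical_le (hb i₀)
  simp only [Complex.VerticalIntegrable, gammaProd, en, eb]
  refine Integrable.mono' (g := fun t => (∏ l, Real.Gamma (ν l + σ)) *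
    ((C * (1 + t ^ 2)⁻¹) * ∏ l ∈ Finset.univ.erase i₀, Real.Gamma (b l - σ)))
    (((integrable_inv_one_add_sq.const_mul C).mul_const _).const_mul _) ?_ ?_
  · exact ((continuous_finsetProd _ fun l _ => continuous_Gamma_vertical (hn l)).mul
      (continuous_finsetProd _ fun l _ => continuous_Gamma_vertical (hb l))).aestronglyMeasurable
  · refine ae_of_all _ fun t => ?_
    rw [norm_mul, norm_prod, norm_prod, ← Finset.mul_prod_erase _ _ (Finset.mem_univ i₀)]
    have hΓ : ∀ x y : ℝ, 0 < x → ‖Complex.Gamma (x + y * Complex.I)‖ ≤ Real.Gamma x :=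
      fun x y hx => by
        simpa using norm_Gamma_le_Gamma_re (z := x + y * Complex.I) (by simpa using hx)
    have h1 := hC (-1 * t)
    have e1 : (-1 * t) ^ 2 = t ^ 2 := by ring
    rw [e1] at h1
    have h0 : ∀ l, 0 ≤ Real.Gamma (ν l + σ) := fun l => (Real.Gamma_pos_of_pos (hn l)).le
    refine mul_le_mul (Finset.prod_le_prod (fun _ _ => norm_nonneg _) fun l _ => hΓ _ _ (hn l))
      (mul_le_mul h1 (Finset.prod_le_prod (fun _ _ => norm_nonneg _) fun l _ => hΓ _ _ (hb l))
        (Finset.prod_nonneg fun _ _ => norm_nonneg _) ((norm_nonneg _).trans h1))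
      (mul_nonneg (norm_nonneg _) (Finset.prod_nonneg fun _ _ => norm_nonneg _))
      (Finset.prod_nonneg fun l _ => h0 l)

theorem mellinInv_gammaProd {r s : ℕ} (hs : 1 ≤ s) {ν : Fin r → ℝ} {b : Fin s → ℝ} {f : ℝ → ℂ}
    (hf : MellinPair f (gammaProd ν b) (gammaStrip ν b)) {σ : ℝ} (hσ : σ ∈ gammaStrip ν b)
    {x : ℝ} (hx : 0 < x) : mellinInv σ (gammaProd ν b) x = f x := by
  have hline : ∀ t : ℝ, mellin f (σ + t * Complex.I) = gammaProd ν b (σ + t * Complex.I) :=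
    fun t => (hf.hasMellin _ (by simpa using hσ)).2
  rw [← mellinInv_mellin_eq σ f hx (hf.hasMellin σ (by simpa using hσ)).1 ?_
    (hf.continuousOn.continuousAt (Ioi_mem_nhds hx))]
  · simp only [mellinInv, hline]
  · simp only [Complex.VerticalIntegrable, hline]
    exact verticalIntegrable_gammaProd hs ν b hσ

/-! ### From the Meijer function to the Mellin inverse -/

/-- The second family of Gamma parameters of row `j`: `1 - upperParam μ j`, as real numbers. -/
def rowParam {N s : ℕ} (μ : Fin s → ℝ) (j : Fin N) (l : Fin s) : ℝ :=
  if l.val = 0 then 1 + μ l + j.val + N else 1 + μ l + N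

theorem one_sub_upperParam {N s : ℕ} (μ : Fin s → ℝ) (j : Fin N) (l : Fin s) :
    1 - upperParam μ j l = rowParam μ j l := by
  unfold upperParam rowParam
  split_ifs <;> push_cast <;> ring

theorem meijerSymbol_eq_gammaProd {N r s : ℕ} (ν : Fin r → ℝ) (μ : Fin s → ℝ) (j : Fin N)
    (u : ℂ) : meijerSymbol r s (upperParam μ j) (lowerParam ν) u =
      gammaProd ν (rowParam μ j) (-u) := by
  have hF : ∀ n : ℕ, (Finset.univ.filter fun l : Fin n => n ≤ l.val) = ∅ := fun n =>
    Finset.filter_eq_empty_iff.2 fun l _ => by omega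
  have hT : ∀ n : ℕ, (Finset.univ.filter fun l : Fin n => l.val < n) = Finset.univ := fun n =>
    Finset.filter_eq_self.2 fun l _ => l.isLt
  simp only [meijerSymbol, gammaProd, hF, hT, Finset.prod_empty, mul_one, div_one,
    one_sub_upperParam, lowerParam, sub_neg_eq_add, ← sub_eq_add_neg]

theorem neg_mem_gammaStrip {N r s : ℕ} {ν : Fin r → ℝ} {μ : Fin s → ℝ} {j : Fin N} {c : ℝ}
    (hc : IsMeijerLine r s (upperParam μ j) (lowerParam ν) c) :
    -c ∈ gammaStrip ν (rowParam μ j) := by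
  refine ⟨fun l => ?_, fun l => ?_⟩
  · have := hc.1 l l.isLt
    simp only [lowerParam, Complex.ofReal_re] at this
    linarith
  · have h1 := hc.2 l l.isLt
    have h2 := congrArg Complex.re (one_sub_upperParam μ j l)
    simp only [Complex.sub_re, Complex.one_re, Complex.ofReal_re] at h2
    linarith

/-- The kernels are `x ^ u` and `x ^ (-s)`, so `s = -u`: the line changes sign and `t` is replaced
by `-t`. -/
theorem meijerG_eq_mellinInv {N r s : ℕ} (ν : Fin r → ℝ) (μ : Fin s → ℝ) (j : Fin N) (c : ℝ)
    (x : ℝ) : meijerG r s (upperParam μ j) (lowerParam ν) c (x : ℂ) =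
      mellinInv (-c) (gammaProd ν (rowParam μ j)) x := by
  rw [meijerG, mellinInv, integral_mul_const,
    ← integral_neg_eq_self (fun y : ℝ => (x : ℂ) ^ (-((-c : ℝ) + y * Complex.I)) •
      gammaProd ν (rowParam μ j) ((-c : ℝ) + y * Complex.I))]
  have e : ∀ t : ℝ, (x : ℂ) ^ (-((-c : ℝ) + (-t : ℝ) * Complex.I)) •
      gammaProd ν (rowParam μ j) ((-c : ℝ) + (-t : ℝ) * Complex.I) =
      meijerSymbol r s (upperParam μ j) (lowerParam ν) (c + t * Complex.I) *
        (x : ℂ) ^ (c + t * Complex.I) := fun t => by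
    have e1 : ((-c : ℝ) : ℂ) + (-t : ℝ) * Complex.I = -(c + t * Complex.I) := by push_cast; ring
    rw [meijerSymbol_eq_gammaProd, e1, neg_neg, smul_eq_mul, mul_comm]
  simp only [e, Complex.real_smul]
  have hI := Complex.I_ne_zero
  push_cast
  field_simp

/-- The points `1, …, N` are where the moments of degree `0, …, N - 1` are evaluated; parameters
above `-1` put them in every strip. -/
theorem natCast_add_one_mem_gammaStrip {N r s : ℕ} {ν : Fin r → ℝ} {μ : Fin s → ℝ}
    (hν : ∀ l, -1 < ν l) (hμ : ∀ l, -1 < μ l) (j p : Fin N) :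
    (p.val : ℝ) + 1 ∈ gammaStrip ν (rowParam μ j) := by
  have hp : (0 : ℝ) ≤ p.val := Nat.cast_nonneg _
  have hj : (0 : ℝ) ≤ j.val := Nat.cast_nonneg _
  have hpN : (p.val : ℝ) + 1 ≤ N := by exact_mod_cast p.isLt
  refine ⟨fun l => by linarith [hν l], fun l => ?_⟩
  unfold rowParam
  split_ifs <;> linarith [hμ l]

/-! ### Andréief's identity -/

/-- Andréief's identity. -/
theorem integral_det_mul_det {α n : Type*} [MeasurableSpace α] [Fintype n] [DecidableEq n]
    (m : Measure α) [SigmaFinite m] (f g : n → α → ℂ)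
    (h : ∀ i j, Integrable (fun x => f i x * g j x) m) :
    Integrable (fun x : n → α => (Matrix.of fun i k => f i (x k)).det *
      (Matrix.of fun j k => g j (x k)).det) (Measure.pi fun _ => m) ∧
    ∫ x : n → α, (Matrix.of fun i k => f i (x k)).det * (Matrix.of fun j k => g j (x k)).det
      ∂(Measure.pi fun _ => m) =
    (Fintype.card n).factorial * (Matrix.of fun i j => ∫ x, f i x * g j x ∂m).det := by
  have hexp : ∀ x : n → α, (Matrix.of fun i k => f i (x k)).det *
      (Matrix.of fun j k => g j (x k)).det =
      ∑ σ : Equiv.Perm n, ∑ τ : Equiv.Perm n,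
        ((Equiv.Perm.sign σ : ℤ) : ℂ) * ((Equiv.Perm.sign τ : ℤ) : ℂ) *
          ∏ k, f (σ k) (x k) * g (τ k) (x k) := fun x => by
    rw [Matrix.det_apply', Matrix.det_apply', Finset.sum_mul_sum]
    refine Finset.sum_congr rfl fun σ _ => Finset.sum_congr rfl fun τ _ => ?_
    rw [Finset.prod_mul_distrib]
    simp only [Matrix.of_apply]
    ring
  have hint : ∀ σ τ : Equiv.Perm n, Integrable (fun x : n → α =>
      ((Equiv.Perm.sign σ : ℤ) : ℂ) * ((Equiv.Perm.sign τ : ℤ) : ℂ) *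
          ∏ k, f (σ k) (x k) * g (τ k) (x k)) (Measure.pi fun _ => m) := fun σ τ =>
    (Integrable.fintype_prod (f := fun k x => f (σ k) x * g (τ k) x)
      fun k => h (σ k) (τ k)).const_mul _
  simp only [hexp]
  refine ⟨integrable_finsetSum _ fun σ _ => integrable_finsetSum _ fun τ _ => hint σ τ, ?_⟩
  rw [integral_finsetSum _ fun σ _ => integrable_finsetSum _ fun τ _ => hint σ τ]
  -- For fixed `σ` the sum over `τ` is the moment determinant with rows permuted by `σ`; the two
  -- signs of `σ` cancel, so each `σ` contributes equally.
  have hσ : ∀ σ : Equiv.Perm n, ∫ x : n → α, ∑ τ : Equiv.Perm n,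
        ((Equiv.Perm.sign σ : ℤ) : ℂ) * ((Equiv.Perm.sign τ : ℤ) : ℂ) *
          ∏ k, f (σ k) (x k) * g (τ k) (x k) ∂(Measure.pi fun _ => m) =
      (Matrix.of fun i j => ∫ x, f i x * g j x ∂m).det := fun σ => by
    rw [integral_finsetSum _ fun τ _ => hint σ τ, ← Matrix.det_transpose, Matrix.det_apply']
    have hperm := Matrix.det_permute σ
      (Matrix.of fun i j => ∫ x, f i x * g j x ∂m)
    have hs2 : ((Equiv.Perm.sign σ : ℤ) : ℂ) * ((Equiv.Perm.sign σ : ℤ) : ℂ) = 1 := by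
      norm_cast
      simp
    rw [← Matrix.det_apply', Matrix.det_transpose]
    calc _ = ((Equiv.Perm.sign σ : ℤ) : ℂ) *
          (((Matrix.of fun i j => ∫ x, f i x * g j x ∂m).submatrix σ id).transpose).det := by
          rw [Matrix.det_apply', Finset.mul_sum]
          refine Finset.sum_congr rfl fun τ _ => ?_
          rw [integral_const_mul,
            integral_fintype_prod_eq_prod (fun k x => f (σ k) x * g (τ k) x), mul_assoc]
          rfl
      _ = _ := by rw [Matrix.det_transpose, hperm, ← mul_assoc, hs2, one_mul]
  simp only [hσ]
  rw [Finset.sum_const, Finset.card_univ, Fintype.card_perm, nsmul_eq_mul]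

/-! ### The moment determinant -/

theorem Gamma_add_natCast {z : ℂ} (hz : 0 < z.re) (n : ℕ) :
    Complex.Gamma (z + n) = Complex.Gamma z * (ascPochhammer ℂ n).eval z := by
  induction n with
  | zero => simp
  | succ n ih =>
    have : z + n ≠ 0 := fun h => by
      have := congrArg Complex.re h
      simp at this
      have : (0 : ℝ) ≤ n := n.cast_nonneg
      linarith
    rw [Nat.cast_succ, ← add_assoc, Complex.Gamma_add_one _ this, ih, ascPochhammer_succ_eval]
    ring

/-- After `Γ(a p)` is pulled out of each row, column `j` is a monic polynomial of degree `j` in `a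
p`, and column operations leave the Vandermonde. -/
theorem det_Gamma_add {N : ℕ} (a : Fin N → ℂ) (ha : ∀ p, 0 < (a p).re) :
    (Matrix.of fun p j : Fin N => Complex.Gamma (a p + (j.val : ℂ))).det =
      (∏ p, Complex.Gamma (a p)) * (Matrix.vandermonde a).det := by
  have e : (Matrix.of fun p j : Fin N => Complex.Gamma (a p + (j.val : ℂ))) =
      Matrix.of fun p j : Fin N => Complex.Gamma (a p) *
        (Matrix.of (fun i j : Fin N => (ascPochhammer ℂ j.val).eval (a i))) p j := by
    ext p j
    simp [Gamma_add_natCast (ha p)]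
  rw [e, Matrix.det_mul_column, Matrix.det_eval_matrixOfPolynomials_eq_det_vandermonde a
    (fun j => ascPochhammer ℂ j.val) (fun j => ascPochhammer_natDegree _ _)
    fun j => monic_ascPochhammer _ _]

theorem det_vandermonde_sub_val (N : ℕ) (z : ℂ) :
    (Matrix.vandermonde fun p : Fin N => z - (p.val : ℂ)).det =
      ∏ l ∈ Finset.range N, ((-1) ^ l * (l.factorial : ℂ)) := by
  rw [Matrix.det_vandermonde]
  -- Grouping by the larger index `j`, the differences `i - j` over `i < j` multiply to `(-1) ^ j *
  -- j!`, independently of `z`.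
  have hswap : ∏ i : Fin N, ∏ j ∈ Finset.Ioi i, ((z - (j.val : ℂ)) - (z - (i.val : ℂ))) =
      ∏ j : Fin N, ∏ i ∈ Finset.Iio j, ((z - (j.val : ℂ)) - (z - (i.val : ℂ))) :=
    Finset.prod_comm' (by simp)
  rw [hswap, ← Fin.prod_univ_eq_prod_range (fun l => (-1) ^ l * (l.factorial : ℂ))]
  refine Finset.prod_congr rfl fun j _ => ?_
  have h1 : ∏ i ∈ Finset.Iio j, ((z - (j.val : ℂ)) - (z - (i.val : ℂ))) =
      ∏ i ∈ Finset.range j.val, (-1 * ((j.val : ℂ) - i)) := by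
    rw [← Nat.Iio_eq_range, ← Fin.map_valEmbedding_Iio, Finset.prod_map]
    refine Finset.prod_congr rfl fun i _ => ?_
    simp only [Fin.valEmbedding_apply]
    ring
  rw [h1, Finset.prod_mul_distrib, Finset.prod_const, Finset.card_range,
    ← Finset.prod_range_reflect, ← Finset.prod_range_add_one_eq_factorial, Nat.cast_prod]
  congr 1
  refine Finset.prod_congr rfl fun i hi => ?_
  have := Finset.mem_range.1 hi
  rw [Nat.sub_sub, Nat.cast_sub (by omega)]
  push_cast
  ring

theorem det_gammaProd {N r s : ℕ} (hs : 1 ≤ s) {ν : Fin r → ℝ} {μ : Fin s → ℝ}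
    (hμ : ∀ l, -1 < μ l) :
    (Matrix.of fun p j : Fin N => gammaProd ν (rowParam μ j) ((p.val : ℂ) + 1)).det =
      ∏ l ∈ Finset.range N, ((normConst N ν μ l : ℝ) : ℂ) := by
  let i₀ : Fin s := ⟨0, hs⟩
  -- `A p` collects the factors free of the column index; the remaining one is `Γ(a p + j)`. The
  -- `l!` from the Vandermonde becomes the `ν₀ = 0` factor of `C_l`.
  let A : Fin N → ℂ := fun p => (∏ l, Complex.Gamma (ν l + ((p.val : ℂ) + 1))) *
    ∏ l ∈ Finset.univ.erase i₀, Complex.Gamma (μ l + N - p.val)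
  let a : Fin N → ℂ := fun p => (μ i₀ + N : ℂ) - p.val
  have ha : ∀ p, 0 < (a p).re := fun p => by
    have hpN : (p.val : ℝ) + 1 ≤ N := by exact_mod_cast p.isLt
    simp only [a, Complex.sub_re, Complex.add_re, Complex.ofReal_re, Complex.natCast_re]
    linarith [hμ i₀]
  have hM : (Matrix.of fun p j : Fin N => gammaProd ν (rowParam μ j) ((p.val : ℂ) + 1)) =
      Matrix.of fun p j : Fin N => A p *
        (Matrix.of fun p j : Fin N => Complex.Gamma (a p + (j.val : ℂ))) p j := by
    ext p j
    simp only [Matrix.of_apply, gammaProd, A, mul_assoc]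
    congr 1
    rw [← Finset.mul_prod_erase Finset.univ _ (Finset.mem_univ i₀), mul_comm]
    congr 1
    · refine Finset.prod_congr rfl fun l hl => ?_
      have : l.val ≠ 0 := fun h => Finset.ne_of_mem_erase hl (Fin.ext h)
      simp only [rowParam, if_neg this]
      push_cast
      ring_nf
    · simp only [rowParam, i₀, a, if_true]
      push_cast
      ring_nf
  rw [hM, Matrix.det_mul_column, det_Gamma_add a ha, det_vandermonde_sub_val, ← mul_assoc,
    ← Finset.prod_mul_distrib, ← Fin.prod_univ_eq_prod_range (fun l => (-1) ^ l * (l.factorial : ℂ)),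
    ← Fin.prod_univ_eq_prod_range (fun l => ((normConst N ν μ l : ℝ) : ℂ)),
    ← Finset.prod_mul_distrib]
  refine Finset.prod_congr rfl fun p _ => ?_
  simp only [normConst, Fin.prod_univ_succ, Fin.cons_zero, Fin.cons_succ, zero_add,
    Real.Gamma_nat_eq_factorial]
  push_cast
  simp only [← Complex.Gamma_ofReal]
  rw [← Finset.mul_prod_erase Finset.univ (fun l => Complex.Gamma ((μ l + N - p.val : ℝ) : ℂ))
    (Finset.mem_univ i₀)]
  simp only [A, a]
  push_cast
  simp only [← add_assoc]
  ring

theorem normConst_ne_zero {N r s : ℕ} {ν : Fin r → ℝ} {μ : Fin s → ℝ}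
    (hν : ∀ l, -1 < ν l) (hμ : ∀ l, -1 < μ l) {l : ℕ} (hl : l < N) : normConst N ν μ l ≠ 0 := by
  have h0 : (0 : ℝ) ≤ l := l.cast_nonneg
  have hlN : (l : ℝ) + 1 ≤ N := by exact_mod_cast hl
  refine mul_ne_zero (mul_ne_zero (by simp) (Finset.prod_ne_zero_iff.2 fun j _ => ?_))
    (Finset.prod_ne_zero_iff.2 fun p _ => ?_)
  · refine (Real.Gamma_pos_of_pos ?_).ne'
    refine Fin.cases ?_ (fun i => ?_) j
    · simp only [Fin.cons_zero]
      linarith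
    · simp only [Fin.cons_succ]
      linarith [hν i]
  · exact (Real.Gamma_pos_of_pos (by linarith [hμ p])).ne'

/-! ### Integrating the weight -/

theorem eigenvalueWeight_eq {N r s : ℕ} (hs : 1 ≤ s) {ν : Fin r → ℝ} {μ : Fin s → ℝ}
    {c : Fin N → ℝ} (hc : ∀ j : Fin N, IsMeijerLine r s (upperParam μ j) (lowerParam ν) (c j))
    {f : Fin N → ℝ → ℂ}
    (hf : ∀ j, MellinPair (f j) (gammaProd ν (rowParam μ j)) (gammaStrip ν (rowParam μ j)))
    {x : Fin N → ℝ} (hx : ∀ k, 0 < x k) :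
    eigenvalueWeight ν μ c x = (Matrix.of fun p k : Fin N => (x k : ℂ) ^ p.val).det *
      (Matrix.of fun j k : Fin N => f j (x k)).det := by
  rw [eigenvalueWeight, ← Matrix.det_vandermonde fun k => (x k : ℂ), ← Matrix.det_transpose]
  congr 2
  ext j k
  rw [Matrix.of_apply, Matrix.of_apply, meijerG_eq_mellinInv,
    mellinInv_gammaProd hs (hf j) (neg_mem_gammaStrip (hc j)) (hx k)]

theorem integral_eigenvalueWeight {N r s : ℕ} (hs : 1 ≤ s) {ν : Fin r → ℝ} {μ : Fin s → ℝ}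
    (hν : ∀ l, -1 < ν l) (hμ : ∀ l, -1 < μ l) {c : Fin N → ℝ}
    (hc : ∀ j : Fin N, IsMeijerLine r s (upperParam μ j) (lowerParam ν) (c j))
    {f : Fin N → ℝ → ℂ}
    (hf : ∀ j, MellinPair (f j) (gammaProd ν (rowParam μ j)) (gammaStrip ν (rowParam μ j))) :
    IntegrableOn (eigenvalueWeight ν μ c) (univ.pi fun _ : Fin N => Ioi (0 : ℝ)) ∧
    ∫ x in univ.pi (fun _ : Fin N => Ioi (0 : ℝ)), eigenvalueWeight ν μ c x =
      N.factorial * ∏ l ∈ Finset.range N, ((normConst N ν μ l : ℝ) : ℂ) := by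
  -- The Mellin kernel is `x ^ (s - 1)`, so the `p`-th moment is the transform at `p + 1`.
  have hmom : ∀ p j : Fin N, HasMellin (f j) ((p.val : ℂ) + 1)
      (gammaProd ν (rowParam μ j) ((p.val : ℂ) + 1)) := fun p j =>
    (hf j).hasMellin _ (by simpa using natCast_add_one_mem_gammaStrip hν hμ j p)
  simp only [HasMellin, MellinConvergent, mellin, add_sub_cancel_right, Complex.cpow_natCast,
    smul_eq_mul] at hmom
  obtain ⟨h1, h2⟩ := integral_det_mul_det (volume.restrict (Ioi (0 : ℝ)))
    (fun (p : Fin N) x => (x : ℂ) ^ p.val) f fun p j => (hmom p j).1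
  simp only [(hmom _ _).2, det_gammaProd hs hμ, Fintype.card_fin] at h2
  have hmeas : MeasurableSet (univ.pi fun _ : Fin N => Ioi (0 : ℝ)) :=
    MeasurableSet.univ_pi fun _ => measurableSet_Ioi
  rw [← Measure.restrict_pi_pi, ← volume_pi] at h1 h2
  have hEq : EqOn (fun x : Fin N → ℝ => (Matrix.of fun p k : Fin N => (x k : ℂ) ^ p.val).det *
      (Matrix.of fun j k : Fin N => f j (x k)).det) (eigenvalueWeight ν μ c)
      (univ.pi fun _ : Fin N => Ioi (0 : ℝ)) := fun x hx =>
    (eigenvalueWeight_eq hs hc hf fun k => hx k (mem_univ k)).symm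
  exact ⟨IntegrableOn.congr_fun h1 hEq hmeas, by rw [← setIntegral_congr_fun hmeas hEq, h2]⟩

theorem im_eigenvalueWeight {N r s : ℕ} (hs : 1 ≤ s) {ν : Fin r → ℝ} {μ : Fin s → ℝ}
    {c : Fin N → ℝ} (hc : ∀ j : Fin N, IsMeijerLine r s (upperParam μ j) (lowerParam ν) (c j))
    {f : Fin N → ℝ → ℂ}
    (hf : ∀ j, MellinPair (f j) (gammaProd ν (rowParam μ j)) (gammaStrip ν (rowParam μ j)))
    {x : Fin N → ℝ} (hx : ∀ k, 0 < x k) : (eigenvalueWeight ν μ c x).im = 0 := by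
  rw [← Complex.conj_eq_iff_im, eigenvalueWeight_eq hs hc hf hx, map_mul, RingHom.map_det,
    RingHom.map_det]
  congr 2
  · ext p k
    simp
  · ext j k
    simp [(hf j).conj_eq _ (hx k)]

theorem mainTheorem8 (N r s : ℕ) (hs : 1 ≤ s) (ν : Fin r → ℝ) (μ : Fin s → ℝ)
    (hν : ∀ l, -1 < ν l) (hμ : ∀ l, -1 < μ l) (c : Fin N → ℝ)
    (hc : ∀ j : Fin N, IsMeijerLine r s (upperParam μ j) (lowerParam ν) (c j)) :
    (∀ x : Fin N → ℝ, (∀ k, 0 < x k) → (eigenvalueWeight ν μ c x).im = 0) ∧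
    MeasureTheory.IntegrableOn (eigenvalueWeight ν μ c)
      (Set.univ.pi fun _ : Fin N => Set.Ioi (0 : ℝ)) MeasureTheory.volume ∧
    (∀ K : ℂ,
      (∫ x in Set.univ.pi (fun _ : Fin N => Set.Ioi (0 : ℝ)), K * eigenvalueWeight ν μ c x) = 1 ↔
        K = 1 / (N.factorial : ℂ) *
          (1 / ∏ l ∈ Finset.range N, ((normConst N ν μ l : ℝ) : ℂ))) := by

  have hex : ∀ j : Fin N, ∃ f,
      MellinPair f (gammaProd ν (rowParam μ j)) (gammaStrip ν (rowParam μ j)) := fun j =>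
    exists_mellinPair_gammaProd hs ν (rowParam μ j) ⟨_, neg_mem_gammaStrip (hc j)⟩
  choose f hf using hex
  obtain ⟨hint, hval⟩ := integral_eigenvalueWeight hs hν hμ hc hf
  refine ⟨fun x hx => im_eigenvalueWeight hs hc hf hx, hint, fun K => ?_⟩
  have hP : ∏ l ∈ Finset.range N, ((normConst N ν μ l : ℝ) : ℂ) ≠ 0 :=
    Finset.prod_ne_zero_iff.2 fun l hl =>
      Complex.ofReal_ne_zero.2 (normConst_ne_zero hν hμ (Finset.mem_range.1 hl))
  have hfac : (N.factorial : ℂ) ≠ 0 := Nat.cast_ne_zero.2 N.factorial_ne_zero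
  rw [integral_const_mul, hval, one_div_mul_one_div, eq_div_iff (mul_ne_zero hfac hP)]
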